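/- Let $H$ be a finite set of closed halfspaces of a finite-dimensional real vector space, let $P=\bigcap H$, suppose that $P$ is a (nonempty) polyhedron of dimension $D$, let $0\le d\le D$ be an integer, and let $\ell$ be a linear (or affine) real-valued function. The faces of $P$ are $\emptyset$, $P$ itself, and the sets $P\cap h$ where $h$ is a closed halfspace whose boundary is disjoint from the relative interior of $P$; the dimension of a face is the dimension of its affine hull, with $\dim\emptyset=-1$; a vertex is a face consisting of one point. For $S\subseteq H$ let $P_S$ be the intersection of $P$ with the hyperplanes bounding the halfspaces in $S$, and let $\min_\ell P_S$ be the set of points of $P_S$ at which $\ell$ attains its minimum over $P_S$ (the empty set if there is no minimum). Let $V$ be the set of all vertices $v$ of $P$ such that $\min_\ell P_S=\{v\}$ for some $S\subseteq H$ with $|S|\le d$, and let $F$ be a set of bounded faces of $P$ with $\emptyset\in F$. Suppose that the following three conditions hold. 1. For each $S\subseteq H$ with $|S|\le d+1$ and $P_S\ne\emptyset$, $\min_\ell P_S$ is a single vertex belonging to $V$. 2. Every face in $F$ has dimension at most $d$. 3. For every $f\in F$ and $v\in V$, with $A$ the affine hull of $f\cup\{v\}$, at least one of the following is true: (a) $A$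 contains a point of the (relative) interior of $P$ and $d<D-1$; (b) some face $f'\in F$ has affine hull $A$; (c) $\ell$ is unbounded on $A\cap P$. Then $F$ is the bounded subcomplex of $P$, i.e. $F$ is exactly the set of all bounded faces of $P$ (including the empty face). -/

import Mathlib

namespace BoundedFaces

variable {E : Type*} [NormedAddCommGroup E] [NormedSpace ℝ E]

/-- A (proper) closed halfspace `{x | normal x ≤ offset}`, with nonzero normal functional. -/
structure Halfspace (E : Type*) [NormedAddCommGroup E] [NormedSpace ℝ E] where
  normal : Module.Dual ℝ E
  normal_ne_zero : normal ≠ 0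
  offset : ℝ

/-- The set of points of the closed halfspace. -/
def Halfspace.carrier (h : Halfspace E) : Set E := {x | h.normal x ≤ h.offset}

/-- The bounding hyperplane of the halfspace. -/
def Halfspace.boundary (h : Halfspace E) : Set E := {x | h.normal x = h.offset}

/-- The polyhedron `⋂ H` cut out by a finite set `H` of closed halfspaces. -/
def polyhedron (H : Finset (Halfspace E)) : Set E := ⋂ h ∈ H, h.carrier

/-- `P_S`: the intersection of the polyhedron with the hyperplanes bounding the halfspaces
in `S`. -/
def section_ (H S : Finset (Halfspace E)) : Set E := polyhedron H ∩ ⋂ h ∈ S, h.boundary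

/-- The faces of `P`: the sets `P ∩ h` for a closed halfspace `h` whose boundary is disjoint from
the relative interior of `P`. The empty set and `P` itself always count as faces (this only has to
be said separately when no such halfspace exists, e.g. when `P` is the whole space). -/
def IsFace (P f : Set E) : Prop :=
  f = ∅ ∨ f = P ∨
    ∃ h : Halfspace E, Disjoint h.boundary (intrinsicInterior ℝ P) ∧ f = P ∩ h.carrier

/-- A vertex is a face that consists of a single point. -/
def IsVertex (P : Set E) (v : E) : Prop := IsFace P {v}

open Classical in
/-- The dimension of a set is the dimension of its affine hull; the empty set has
dimension `-1`. -/
noncomputable def dim (f : Set E) : ℤ :=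
  if f = ∅ then -1 else (Module.finrank ℝ (affineSpan ℝ f).direction : ℤ)

/-- `min_ℓ Q`: the set of points of `Q` where `ℓ` takes its minimum over `Q`. It is empty if `Q` is
empty or if `ℓ` has no minimum on `Q`. -/
def minFace (l : E →ᵃ[ℝ] ℝ) (Q : Set E) : Set E := {x ∈ Q | ∀ y ∈ Q, l x ≤ l y}

/-- The vertices `v` of the polyhedron with `min_ℓ P_S = {v}` for a set `S` of at most `d` of the
halfspaces. -/
def minVertices (H : Finset (Halfspace E)) (l : E →ᵃ[ℝ] ℝ) (d : ℕ) : Set E :=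
  {v | IsVertex (polyhedron H) v ∧ ∃ S ⊆ H, S.card ≤ d ∧ minFace l (section_ H S) = {v}}

/-- The bounded subcomplex: the set of all bounded faces of `P`, including the empty face. -/
def boundedSubcomplex (P : Set E) : Set (Set E) := {f | IsFace P f ∧ Bornology.IsBounded f}

end BoundedFaces

/-! Every face is empty or a section `P_S`, and sections form a finite family, so extremal choices
among sections can replace the face lattice. Condition 1 for `S = ∅` gives `l` a unique minimum
point on `P`, so `l` tends to infinity along every ray in `P`.

The proof has two halves. First, a section lies in `F` if `l` is bounded above on it and its
vertices are in `V`: a minimal counterexample has the same affine hull as some `f' ∪ {v}` with `v` a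
vertex and `f' ∈ F` (`exists_facet`), and every alternative of condition 3 then gives a
contradiction. Second, `V` contains all vertices: for a lowest missing `v`, take a maximal section
`g` on which `v` is the strict top. As above, `g` is spanned by `v` and some `f'`, whose vertices
lie below `v`; so `f' ∈ F` and `dim g ≤ d + 1`. Farkas' lemma with at most `dim g` multipliers makes
`v` a minimum of `l` on a section by at most `d + 1` halfspaces (`exists_mem_minFace`), so `v ∈ V`
by condition 1. -/

namespace BoundedFaces

open Filter Topology

variable {E : Type*} [NormedAddCommGroup E] [NormedSpace ℝ E]

/-! ### Farkas' lemma with a bound on the support -/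

/-- Farkas' lemma on a subspace `W`, with at most `dim W` multipliers. -/
theorem exists_nonneg_combination_of_le_zero [FiniteDimensional ℝ E] {ι : Type*}
    (n : ι → Module.Dual ℝ E) (l : Module.Dual ℝ E) (I : Finset ι) :
    ∀ W : Submodule ℝ E, (∀ u ∈ W, (∀ i ∈ I, n i u ≤ 0) → l u ≤ 0) →
      ∃ S ⊆ I, S.card ≤ Module.finrank ℝ W ∧ ∃ μ : ι → ℝ, (∀ i ∈ S, 0 ≤ μ i) ∧
        ∀ u ∈ W, l u = ∑ i ∈ S, μ i * n i u := by
  classical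
  induction I using Finset.induction_on with
  | empty =>
    intro W hW
    refine ⟨∅, le_rfl, by simp, 0, by simp, fun u hu => ?_⟩
    have h₁ := hW u hu (by simp)
    have h₂ := hW (-u) (W.neg_mem hu) (by simp)
    simp only [map_neg] at h₂
    simp only [Finset.sum_empty]
    linarith
  | insert a I ha ih =>
    intro W hW
    -- If `a` cannot be dropped, passing to the kernel of `n a` costs one dimension and pays for one
    -- multiplier.
    by_cases hI : ∀ u ∈ W, (∀ i ∈ I, n i u ≤ 0) → l u ≤ 0
    · obtain ⟨S, hS, hr⟩ := ih W hI
      exact ⟨S, hS.trans (Finset.subset_insert a I), hr⟩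
    push Not at hI
    obtain ⟨u₀, hu₀, hI, hl⟩ := hI
    have hpos : 0 < n a u₀ := by
      by_contra! hle
      exact absurd (hW u₀ hu₀ (by simpa [hle] using hI)) hl.not_ge
    obtain ⟨S, hS, hcard, μ, hμ, hlin⟩ := ih (W ⊓ LinearMap.ker (n a)) (by
      rintro u ⟨huW, hua⟩ hu
      refine hW u huW fun i hi => ?_
      rcases Finset.mem_insert.1 hi with rfl | hi
      · exact (LinearMap.mem_ker.1 hua).le
      · exact hu i hi)
    have haS : a ∉ S := fun h => ha (hS h)
    have hlt : Module.finrank ℝ (W ⊓ LinearMap.ker (n a) : Submodule ℝ E)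
        < Module.finrank ℝ W := by
      refine Submodule.finrank_lt_finrank_of_lt (lt_of_le_of_ne inf_le_left fun h => ?_)
      have : u₀ ∈ W ⊓ LinearMap.ker (n a) := by rw [h]; exact hu₀
      exact hpos.ne' (LinearMap.mem_ker.1 this.2)
    -- The value of `c` is forced by the identity at `u₀`, which together with the kernel of `n a`
    -- spans `W`.
    set c : ℝ := (l u₀ - ∑ i ∈ S, μ i * n i u₀) / n a u₀ with hc
    refine ⟨insert a S, Finset.insert_subset_insert a hS, ?_,
      Function.update μ a c, ?_, fun u hu => ?_⟩
    · rw [Finset.card_insert_of_notMem haS]; omega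
    · intro i hi
      rcases Finset.mem_insert.1 hi with rfl | hi
      · rw [Function.update_self]
        refine div_nonneg (sub_nonneg.2 (le_trans ?_ hl.le)) hpos.le
        exact Finset.sum_nonpos fun i hi =>
          mul_nonpos_of_nonneg_of_nonpos (hμ i hi) (hI i (hS hi))
      · rw [Function.update_of_ne (ne_of_mem_of_not_mem hi haS)]
        exact hμ i hi
    · have hsum : ∑ i ∈ S, Function.update μ a c i * n i u = ∑ i ∈ S, μ i * n i u :=
        Finset.sum_congr rfl fun i hi => by
          rw [Function.update_of_ne (ne_of_mem_of_not_mem hi haS)]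
      rw [Finset.sum_insert haS, Function.update_self, hsum]
      have hproj := hlin (u - (n a u / n a u₀) • u₀)
        ⟨W.sub_mem hu (W.smul_mem _ hu₀), by
          simp [LinearMap.mem_ker, div_mul_cancel₀ _ hpos.ne']⟩
      simp only [map_sub, map_smul, smul_eq_mul, mul_sub, Finset.sum_sub_distrib] at hproj
      have hfac : ∑ i ∈ S, μ i * (n a u / n a u₀ * n i u₀)
          = n a u / n a u₀ * ∑ i ∈ S, μ i * n i u₀ := by
        rw [Finset.mul_sum]
        exact Finset.sum_congr rfl fun i _ => by ring
      rw [hfac] at hproj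
      have : c * n a u = n a u / n a u₀ * (l u₀ - ∑ i ∈ S, μ i * n i u₀) := by
        rw [hc]; ring
      rw [this]
      linarith

/-! ### Sections of a polyhedron -/

theorem mem_polyhedron {H : Finset (Halfspace E)} {x : E} :
    x ∈ polyhedron H ↔ ∀ h ∈ H, h.normal x ≤ h.offset := by
  simp [polyhedron, Halfspace.carrier]

theorem mem_section {H S : Finset (Halfspace E)} {x : E} :
    x ∈ section_ H S ↔ x ∈ polyhedron H ∧ ∀ h ∈ S, h.normal x = h.offset := by
  simp [section_, Halfspace.boundary]

theorem mem_section_insert [DecidableEq (Halfspace E)] {H S : Finset (Halfspace E)}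
    {h : Halfspace E} {x : E} :
    x ∈ section_ H (insert h S) ↔ x ∈ section_ H S ∧ h.normal x = h.offset := by
  simp only [mem_section, Finset.forall_mem_insert]
  tauto

theorem section_empty (H : Finset (Halfspace E)) : section_ H ∅ = polyhedron H := by
  simp [section_]

theorem section_subset (H S : Finset (Halfspace E)) : section_ H S ⊆ polyhedron H :=
  Set.inter_subset_left

theorem convex_polyhedron (H : Finset (Halfspace E)) : Convex ℝ (polyhedron H) :=
  convex_iInter₂ fun h _ => convex_halfSpace_le h.normal.isLinear h.offset

theorem convex_section (H S : Finset (Halfspace E)) : Convex ℝ (section_ H S) :=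
  (convex_polyhedron H).inter
    (convex_iInter₂ fun h _ => convex_hyperplane h.normal.isLinear h.offset)

theorem normal_eq_of_mem_affineSpan {n : Module.Dual ℝ E} {b : ℝ} {f : Set E}
    (hf : ∀ x ∈ f, n x = b) {x : E} (hx : x ∈ affineSpan ℝ f) : n x = b := by
  have hle : affineSpan ℝ f ≤
      (AffineSubspace.mk' b (⊥ : Submodule ℝ ℝ)).comap n.toAffineMap :=
    affineSpan_le.2 fun y hy => by simp [hf y hy]
  simpa [sub_eq_zero] using hle hx

/-- Consequently, sections with the same affine hull are equal. -/
theorem affineSpan_section_inter (H S : Finset (Halfspace E)) :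
    (affineSpan ℝ (section_ H S) : Set E) ∩ polyhedron H = section_ H S := by
  refine Set.Subset.antisymm (fun x hx => mem_section.2 ⟨hx.2, fun h hh => ?_⟩)
    fun x hx => ⟨subset_affineSpan ℝ _ hx, section_subset H S hx⟩
  exact normal_eq_of_mem_affineSpan (fun y hy => (mem_section.1 hy).2 h hh) hx.1

theorem exists_pos_add_smul_mem {H : Finset (Halfspace E)} {x u : E} (hx : x ∈ polyhedron H)
    (hu : ∀ h ∈ H, h.normal x = h.offset → h.normal u ≤ 0) :
    ∃ ε : ℝ, 0 < ε ∧ x + ε • u ∈ polyhedron H := by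
  have hev : ∀ᶠ ε in 𝓝[>] (0 : ℝ), ∀ h ∈ H, h.normal (x + ε • u) ≤ h.offset := by
    rw [Finset.eventually_all]
    intro h hh
    rcases (mem_polyhedron.1 hx h hh).eq_or_lt with heq | hlt
    · filter_upwards [self_mem_nhdsWithin] with ε hε
      have := mul_nonpos_of_nonneg_of_nonpos (le_of_lt hε) (hu h hh heq)
      simp only [map_add, map_smul, smul_eq_mul]
      linarith
    · have hc : Continuous fun ε : ℝ => h.normal x + ε * h.normal u := by fun_prop
      have h0 := (hc.tendsto 0).mono_left (nhdsWithin_le_nhds (s := Set.Ioi 0))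
      simp only [zero_mul, add_zero] at h0
      filter_upwards [h0.eventually (gt_mem_nhds hlt)] with ε hε
      simpa using hε.le
  obtain ⟨ε, hε, hpos⟩ := (hev.and self_mem_nhdsWithin).exists
  exact ⟨ε, hpos, mem_polyhedron.2 hε⟩

/-- A nonempty convex part of a polyhedron has a point at which only those constraints are tight
that are tight on the whole part. -/
theorem exists_generic {H : Finset (Halfspace E)} {f : Set E} (hfH : f ⊆ polyhedron H)
    (hconv : Convex ℝ f) (hne : f.Nonempty) :
    ∃ x ∈ f, ∀ h ∈ H, h.normal x = h.offset → ∀ y ∈ f, h.normal y = h.offset := by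
  classical
  let c : E → ℕ := fun x => (H.filter fun h => h.normal x = h.offset).card
  -- With the number of tight constraints minimal at `x`, a midpoint argument works: a constraint
  -- tight at a midpoint is tight at both ends.
  obtain ⟨x, hx, hmin⟩ := exists_minimalFor_of_wellFoundedLT (· ∈ f) c hne
  refine ⟨x, hx, fun h hh heq y hy => ?_⟩
  by_contra hne'
  have hz : (1 / 2 : ℝ) • x + (1 / 2 : ℝ) • y ∈ f :=
    hconv hx hy (by norm_num) (by norm_num) (by norm_num)
  have key : ∀ k ∈ H, k.normal ((1 / 2 : ℝ) • x + (1 / 2 : ℝ) • y) = k.offset →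
      k.normal x = k.offset ∧ k.normal y = k.offset := by
    intro k hk hkz
    have h₁ := mem_polyhedron.1 (hfH hx) k hk
    have h₂ := mem_polyhedron.1 (hfH hy) k hk
    simp only [map_add, map_smul, smul_eq_mul] at hkz
    constructor <;> linarith
  have hlt : c ((1 / 2 : ℝ) • x + (1 / 2 : ℝ) • y) < c x := by
    refine Finset.card_lt_card (Finset.ssubset_iff_of_subset ?_ |>.2 ⟨h, ?_, ?_⟩)
    · intro k hk
      rw [Finset.mem_filter] at hk ⊢
      exact ⟨hk.1, (key k hk.1 hk.2).1⟩
    · exact Finset.mem_filter.2 ⟨hh, heq⟩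
    · exact fun hk => hne' (key h hh (Finset.mem_filter.1 hk).2).2
  exact absurd (hmin hz hlt.le) hlt.not_ge

/-- Subtracting from `z - x` as much of `r - x` as the constraints tight at `x` allow makes a
constraint tight that is not tight at `r`. -/
theorem exists_tight_of_sub_smul {H : Finset (Halfspace E)} {x z r : E}
    (hx : x ∈ polyhedron H) (hz : z ∈ polyhedron H) (hr : r ∈ polyhedron H)
    {h₀ : Halfspace E} (hh₀ : h₀ ∈ H) (hx₀ : h₀.normal x = h₀.offset)
    (hr₀ : h₀.normal r ≠ h₀.offset) :
    ∃ t ε : ℝ, 0 ≤ t ∧ 0 < ε ∧ x + ε • ((z - x) - t • (r - x)) ∈ polyhedron H ∧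
      ∃ h ∈ H, h.normal x = h.offset ∧ h.normal r ≠ h.offset ∧
        h.normal (x + ε • ((z - x) - t • (r - x))) = h.offset := by
  classical
  -- The smallest ratio is the largest `t` that the constraints tight at `x` permit.
  obtain ⟨k, hk, hmin⟩ := (H.filter fun h =>
      h.normal x = h.offset ∧ h.normal r ≠ h.offset).exists_min_image
    (fun h => (h.offset - h.normal z) / (h.offset - h.normal r))
    ⟨h₀, by simp [hh₀, hx₀, hr₀]⟩
  obtain ⟨hkH, hkx, hkr⟩ := Finset.mem_filter.1 hk
  have hpos : ∀ h ∈ H, h.normal r ≠ h.offset → 0 < h.offset - h.normal r := fun h hh hne =>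
    sub_pos.2 (lt_of_le_of_ne (mem_polyhedron.1 hr h hh) hne)
  set t : ℝ := (k.offset - k.normal z) / (k.offset - k.normal r) with ht
  have ht0 : 0 ≤ t :=
    div_nonneg (sub_nonneg.2 (mem_polyhedron.1 hz k hkH)) (hpos k hkH hkr).le
  obtain ⟨ε, hε, hmem⟩ := exists_pos_add_smul_mem (u := (z - x) - t • (r - x)) hx (by
    intro h hh hhx
    simp only [map_sub, map_smul, smul_eq_mul, hhx]
    by_cases hhr : h.normal r = h.offset
    · have := mem_polyhedron.1 hz h hh
      rw [hhr]
      linarith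
    · have := (le_div_iff₀ (hpos h hh hhr)).1 (hmin h (Finset.mem_filter.2 ⟨hh, hhx, hhr⟩))
      linarith)
  refine ⟨t, ε, ht0, hε, hmem, k, hkH, hkx, hkr, ?_⟩
  have : t * (k.offset - k.normal r) = k.offset - k.normal z :=
    div_mul_cancel₀ _ (hpos k hkH hkr).ne'
  simp only [map_add, map_sub, map_smul, smul_eq_mul, hkx]
  linear_combination ε * this

/-- If `l` has a unique minimum point on the polyhedron, then every ray on which `l` is bounded
above leaves the polyhedron. -/
theorem exists_exit {H : Finset (Halfspace E)} {l : E →ᵃ[ℝ] ℝ} {v₀ : E}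
    (hv₀ : minFace l (polyhedron H) = {v₀}) {x u : E} (hx : x ∈ polyhedron H) (hu : u ≠ 0)
    {c : ℝ} (hc : ∀ t : ℝ, 0 ≤ t → x + t • u ∈ polyhedron H → l (x + t • u) ≤ c) :
    ∃ t : ℝ, 0 ≤ t ∧ x + t • u ∈ polyhedron H ∧
      ∃ h ∈ H, 0 < h.normal u ∧ h.normal (x + t • u) = h.offset := by
  classical
  have hl : ∀ (y : E) (t : ℝ), l (y + t • u) = l y + t * l.linear u := by
    intro y t
    have := l.map_vadd y (t • u)
    rw [vadd_eq_add, add_comm, vadd_eq_add] at this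
    rw [this, map_smul, smul_eq_mul, add_comm]
  have hv : v₀ ∈ minFace l (polyhedron H) := hv₀ ▸ Set.mem_singleton v₀
  by_cases hK : (H.filter fun h => 0 < h.normal u).Nonempty
  · obtain ⟨k, hk, hmin⟩ := (H.filter fun h => 0 < h.normal u).exists_min_image
      (fun h => (h.offset - h.normal x) / h.normal u) hK
    obtain ⟨hkH, hku⟩ := Finset.mem_filter.1 hk
    have ht0 : 0 ≤ (k.offset - k.normal x) / k.normal u :=
      div_nonneg (sub_nonneg.2 (mem_polyhedron.1 hx k hkH)) hku.le
    refine ⟨(k.offset - k.normal x) / k.normal u, ht0, mem_polyhedron.2 fun h hh => ?_,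
      k, hkH, hku, ?_⟩
    · simp only [map_add, map_smul, smul_eq_mul]
      have hhx := mem_polyhedron.1 hx h hh
      rcases lt_or_ge 0 (h.normal u) with hpos | hneg
      · have := (le_div_iff₀ hpos).1 (hmin h (Finset.mem_filter.2 ⟨hh, hpos⟩))
        linarith
      · have := mul_nonpos_of_nonneg_of_nonpos ht0 hneg
        linarith
    · simp only [map_add, map_smul, smul_eq_mul, div_mul_cancel₀ _ hku.ne']
      ring
  -- Here `u` is a recession direction. If `l` did not increase along it, `v₀ + u` would be a second
  -- minimum point.
  · exfalso
    have hle : ∀ h ∈ H, h.normal u ≤ 0 := fun h hh =>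
      not_lt.1 fun hlt => hK ⟨h, Finset.mem_filter.2 ⟨hh, hlt⟩⟩
    have hray : ∀ y ∈ polyhedron H, ∀ t : ℝ, 0 ≤ t → y + t • u ∈ polyhedron H := by
      intro y hy t ht
      refine mem_polyhedron.2 fun h hh => ?_
      have h₁ := mem_polyhedron.1 hy h hh
      have h₂ := mul_nonpos_of_nonneg_of_nonpos ht (hle h hh)
      simp only [map_add, map_smul, smul_eq_mul]
      linarith
    have hpos : 0 < l.linear u := by
      by_contra! hneg
      have hmem : v₀ + (1 : ℝ) • u ∈ minFace l (polyhedron H) := by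
        refine ⟨hray v₀ hv.1 1 zero_le_one, fun y hy => ?_⟩
        have := hv.2 y hy
        rw [hl]
        linarith
      rw [hv₀, Set.mem_singleton_iff, one_smul, add_eq_left] at hmem
      exact hu hmem
    have hx' := hc 0 le_rfl (by simpa using hx)
    rw [hl] at hx'
    have ht : 0 ≤ (c - l x + 1) / l.linear u := div_nonneg (by linarith) hpos.le
    have := hc _ ht (hray x hx _ ht)
    rw [hl, div_mul_cancel₀ _ hpos.ne'] at this
    linarith

/-! ### Vertices and facets of sections -/

/-- A nonempty section on which `l` is bounded above contains a section that is a single point. -/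
theorem exists_vertex {H : Finset (Halfspace E)} {l : E →ᵃ[ℝ] ℝ} {v₀ : E}
    (hv₀ : minFace l (polyhedron H) = {v₀}) {S : Finset (Halfspace E)} (hS : S ⊆ H)
    (hne : (section_ H S).Nonempty) {c : ℝ} (hc : ∀ x ∈ section_ H S, l x ≤ c) :
    ∃ w ∈ section_ H S, ∃ T ⊆ H, section_ H T = {w} := by
  classical
  obtain ⟨T, hT, hmax⟩ := (H.powerset.filter fun T =>
      (section_ H T).Nonempty ∧ section_ H T ⊆ section_ H S).exists_max_image Finset.card
    ⟨S, by simp [hS, hne]⟩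
  obtain ⟨hTH, ⟨x, hx⟩, hTS⟩ := Finset.mem_filter.1 hT
  rw [Finset.mem_powerset] at hTH
  refine ⟨x, hTS hx, T, hTH, Set.eq_singleton_iff_unique_mem.2 ⟨hx, fun y hy => ?_⟩⟩
  by_contra hyx
  have hT0 : ∀ h ∈ T, h.normal (y - x) = 0 := fun h hh => by
    rw [map_sub, (mem_section.1 hx).2 h hh, (mem_section.1 hy).2 h hh, sub_self]
  have hline : ∀ t : ℝ, x + t • (y - x) ∈ polyhedron H → x + t • (y - x) ∈ section_ H T :=
    fun t ht => mem_section.2 ⟨ht, fun h hh => by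
      rw [map_add, map_smul, hT0 h hh, smul_zero, add_zero, (mem_section.1 hx).2 h hh]⟩
  obtain ⟨t, -, hmem, h, hh, hpos, heq⟩ := exists_exit hv₀ (section_subset H T hx)
    (sub_ne_zero.2 hyx) fun t _ ht => hc _ (hTS (hline t ht))
  have hhT : h ∉ T := fun hhT => hpos.ne' (hT0 h hhT)
  have := hmax (insert h T) (Finset.mem_filter.2
    ⟨Finset.mem_powerset.2 (Finset.insert_subset hh hTH),
      ⟨_, mem_section_insert.2 ⟨hline t hmem, heq⟩⟩,
      fun z hz => hTS (mem_section_insert.1 hz).1⟩)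
  rw [Finset.card_insert_of_notMem hhT] at this
  omega

/-- The empty set and the sections `P_S`. -/
def IsSection (H : Finset (Halfspace E)) (f : Set E) : Prop :=
  f = ∅ ∨ ∃ S ⊆ H, f = section_ H S

theorem finite_isSection (H : Finset (Halfspace E)) : {f | IsSection H f}.Finite := by
  refine ((H.powerset.finite_toSet.image (section_ H)).insert ∅).subset ?_
  rintro f (rfl | ⟨S, hS, rfl⟩)
  · exact Set.mem_insert _ _
  · exact Set.mem_insert_of_mem _ ⟨S, by simpa using hS, rfl⟩

/-- A maximal section that avoids a given point `v` of a section spans it together with `v`. -/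
theorem exists_facet {H : Finset (Halfspace E)} {l : E →ᵃ[ℝ] ℝ} {v₀ : E}
    (hv₀ : minFace l (polyhedron H) = {v₀}) {S : Finset (Halfspace E)} (hS : S ⊆ H)
    {v : E} (hv : v ∈ section_ H S) {c : ℝ} (hc : ∀ x ∈ section_ H S, l x ≤ c) :
    ∃ f, IsSection H f ∧ f ⊆ section_ H S ∧ v ∉ f ∧
      affineSpan ℝ (f ∪ {v}) = affineSpan ℝ (section_ H S) := by
  classical
  obtain ⟨f, ⟨hf, hfS, hvf⟩, hmax⟩ := Set.Finite.exists_maximal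
    (s := {f | IsSection H f ∧ f ⊆ section_ H S ∧ v ∉ f})
    ((finite_isSection H).subset fun f hf => hf.1)
    ⟨∅, Or.inl rfl, Set.empty_subset _, Set.notMem_empty v⟩
  have hmax' : ∀ h ∈ H, h.normal v ≠ h.offset → f ⊆ section_ H (insert h S) →
      section_ H (insert h S) ⊆ f := fun h hh hhv hsub =>
    hmax ⟨Or.inr ⟨_, Finset.insert_subset hh hS, rfl⟩,
      fun z hz => (mem_section_insert.1 hz).1, fun hz => hhv (mem_section_insert.1 hz).2⟩ hsub
  refine ⟨f, hf, hfS, hvf, le_antisymm (affineSpan_mono ℝ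
    (Set.union_subset hfS (Set.singleton_subset_iff.2 hv))) (affineSpan_le.2 fun z hz => ?_)⟩
  have hvA : v ∈ affineSpan ℝ (f ∪ {v}) := subset_affineSpan ℝ _ (Or.inr rfl)
  rcases f.eq_empty_or_nonempty with rfl | hne
  · by_cases hzv : z = v
    · rwa [hzv]
    exfalso
    have hline : ∀ t : ℝ, z + t • (z - v) ∈ polyhedron H → z + t • (z - v) ∈ section_ H S :=
      fun t ht => mem_section.2 ⟨ht, fun h hh => by
        rw [map_add, map_smul, map_sub, (mem_section.1 hz).2 h hh, (mem_section.1 hv).2 h hh,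
          sub_self, smul_zero, add_zero]⟩
    -- The ray from `z` away from `v` exits through a constraint slack at `v`, giving a nonempty
    -- section without `v`.
    obtain ⟨t, ht, hmem, h, hh, hpos, heq⟩ := exists_exit hv₀ (section_subset H S hz)
      (sub_ne_zero.2 hzv) fun t _ ht => hc _ (hline t ht)
    refine hmax' h hh (fun hhv => ?_) (Set.empty_subset _)
      (mem_section_insert.2 ⟨hline t hmem, heq⟩)
    have := mem_polyhedron.1 (section_subset H S hz) h hh
    rw [map_sub] at hpos
    linarith
  · obtain ⟨S', hS', rfl⟩ : ∃ S' ⊆ H, f = section_ H S' := by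
      rcases hf with rfl | hf
      · exact absurd hne Set.not_nonempty_empty
      · exact hf
    obtain ⟨x, hx, hgen⟩ := exists_generic (section_subset H S') (convex_section H S') hne
    obtain ⟨h₀, hh₀, hv₀'⟩ : ∃ h ∈ S', h.normal v ≠ h.offset := by
      by_contra! hall
      exact hvf (mem_section.2 ⟨section_subset H S hv, hall⟩)
    obtain ⟨t, ε, -, hε, hw, h, hh, hhx, hhv, hhw⟩ := exists_tight_of_sub_smul
      (section_subset H S' hx) (section_subset H S hz) (section_subset H S hv)
      (hS' hh₀) ((mem_section.1 hx).2 h₀ hh₀) hv₀'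
    -- The new constraint is tight on all of `f` but not at `v`, so maximality of `f` forces the new
    -- point into `f`. Then `z` is an affine combination of it, `x` and `v`.
    have hwf : x + ε • ((z - x) - t • (v - x)) ∈ section_ H S' := by
      refine hmax' h hh hhv (fun y hy => mem_section_insert.2 ⟨hfS hy, hgen h hh hhx y hy⟩)
        (mem_section_insert.2 ⟨mem_section.2 ⟨hw, fun k hk => ?_⟩, hhw⟩)
      simp only [map_add, map_sub, map_smul, (mem_section.1 (hfS hx)).2 k hk,
        (mem_section.1 hz).2 k hk, (mem_section.1 hv).2 k hk, sub_self, smul_zero, add_zero]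
    set w := x + ε • ((z - x) - t • (v - x)) with hwdef
    have hxA : x ∈ affineSpan ℝ (section_ H S' ∪ {v}) := subset_affineSpan ℝ _ (Or.inl hx)
    have hwA : w ∈ affineSpan ℝ (section_ H S' ∪ {v}) := subset_affineSpan ℝ _ (Or.inl hwf)
    have hz' : z = (t • (v -ᵥ x) + ε⁻¹ • (w -ᵥ x)) +ᵥ x := by
      simp only [hwdef, vsub_eq_sub, vadd_eq_add, add_sub_cancel_left, smul_smul,
        inv_mul_cancel₀ hε.ne', one_smul]
      abel
    rw [SetLike.mem_coe, hz']
    exact AffineSubspace.vadd_mem_of_mem_direction (Submodule.add_mem _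
      (Submodule.smul_mem _ _ (AffineSubspace.vsub_mem_direction hvA hxA))
      (Submodule.smul_mem _ _ (AffineSubspace.vsub_mem_direction hwA hxA))) hxA

/-! ### Dimension, and from strict maxima to minima -/

theorem dim_eq_of_affineSpan_eq {f g : Set E} (h : affineSpan ℝ f = affineSpan ℝ g) :
    dim f = dim g := by
  have : f = ∅ ↔ g = ∅ := by
    rw [← affineSpan_eq_bot ℝ, h, affineSpan_eq_bot]
  unfold dim
  rw [h]
  simp only [this]

theorem dim_union_singleton_le (f : Set E) (v : E) : dim (f ∪ {v}) ≤ dim f + 1 := by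
  rcases f.eq_empty_or_nonempty with rfl | hne
  · rw [Set.empty_union]
    simp [dim, direction_affineSpan]
  · rw [dim, dim, if_neg hne.ne_empty, if_neg (hne.mono Set.subset_union_left).ne_empty,
      Set.union_singleton, direction_affineSpan, direction_affineSpan]
    exact_mod_cast finrank_vectorSpan_insert_le_set ℝ f v

theorem linear_apply_sub (l : E →ᵃ[ℝ] ℝ) (x y : E) : l.linear (x - y) = l x - l y :=
  l.linearMap_vsub x y

/-- If `v` is the strict maximum of `l` on a section that is maximal with this property, then
`v` is a minimum of `l` on a section given by at most as many halfspaces as the dimension of the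
former. -/
theorem exists_mem_minFace [FiniteDimensional ℝ E] {H : Finset (Halfspace E)} {l : E →ᵃ[ℝ] ℝ}
    {v : E} {S : Finset (Halfspace E)} (hS : S ⊆ H) (hv : v ∈ section_ H S)
    (hlt : ∀ x ∈ section_ H S, x ≠ v → l x < l v)
    (hmax : ∀ T ⊆ H, section_ H S ⊆ section_ H T →
      (∀ x ∈ section_ H T, x ≠ v → l x < l v) → section_ H T ⊆ section_ H S) :
    ∃ T ⊆ H, T.card ≤ Module.finrank ℝ (affineSpan ℝ (section_ H S)).direction ∧
      v ∈ minFace l (section_ H T) := by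
  classical
  have hvP := section_subset H S hv
  have hle : ∀ x ∈ section_ H S, l x ≤ l v := fun x hx => by
    by_cases hxv : x = v
    · rw [hxv]
    · exact (hlt x hx hxv).le
  set W := (affineSpan ℝ (section_ H S)).direction with hW
  have hvA : v ∈ affineSpan ℝ (section_ H S) := subset_affineSpan ℝ _ hv
  obtain ⟨R, hR, hcard, μ, hμ, hlin⟩ := exists_nonneg_combination_of_le_zero
    Halfspace.normal l.linear (H.filter fun h => h.normal v = h.offset) W (by
      intro u hu hneg
      obtain ⟨ε, hε, hmem⟩ := exists_pos_add_smul_mem (u := u) hvP fun h hh hhv =>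
        hneg h (Finset.mem_filter.2 ⟨hh, hhv⟩)
      have hA : v + ε • u ∈ affineSpan ℝ (section_ H S) := by
        rw [add_comm]
        exact AffineSubspace.vadd_mem_of_mem_direction (W.smul_mem ε hu) hvA
      have hl := hle _ ((affineSpan_section_inter H S).subset ⟨hA, hmem⟩)
      have hd := linear_apply_sub l (v + ε • u) v
      rw [add_sub_cancel_left, map_smul, smul_eq_mul] at hd
      exact nonpos_of_mul_nonpos_right (by linarith) hε)
  -- `L` is constant on `P_S`, and differs from `l` by a constant on `P_R`. It therefore suffices
  -- that `v` minimizes `L` on all of `P`.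
  set L : Module.Dual ℝ E := l.linear - ∑ h ∈ R, μ h • h.normal with hL
  have hLapp : ∀ u, L u = l.linear u - ∑ h ∈ R, μ h * h.normal u := fun u => by
    simp [hL]
  have hLW : ∀ x ∈ section_ H S, L x = L v := fun x hx => by
    rw [← sub_eq_zero, ← map_sub, hLapp, hlin (x - v) (AffineSubspace.vsub_mem_direction
      (subset_affineSpan ℝ _ hx) hvA), sub_self]
  have hLle : ∀ r ∈ polyhedron H, l v ≤ l r → L v ≤ L r := fun r hr hlr => by
    rw [← sub_nonneg, ← map_sub, hLapp, linear_apply_sub]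
    have : ∑ h ∈ R, μ h * h.normal (r - v) ≤ 0 := Finset.sum_nonpos fun h hh => by
      obtain ⟨hhH, hhv⟩ := Finset.mem_filter.1 (hR hh)
      refine mul_nonpos_of_nonneg_of_nonpos (hμ h hh) ?_
      rw [map_sub, hhv]
      exact sub_nonpos.2 (mem_polyhedron.1 hr h hhH)
    linarith
  have hLmin : ∀ z ∈ polyhedron H, L v ≤ L z := by
    by_contra! hex
    obtain ⟨z₀, hz₀, hLz₀⟩ := hex
    obtain ⟨T, hT, hTmax⟩ := (H.powerset.filter fun T =>
        section_ H S ⊆ section_ H T ∧ ∃ z ∈ section_ H T, L z < L v).exists_max_image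
      Finset.card ⟨∅, by
        simp only [Finset.mem_filter, Finset.mem_powerset, Finset.empty_subset, true_and,
          section_empty]
        exact ⟨section_subset H S, z₀, hz₀, hLz₀⟩⟩
    obtain ⟨hTH, hST, z, hz, hLz⟩ := Finset.mem_filter.1 hT
    rw [Finset.mem_powerset] at hTH
    -- Otherwise `v` is the strict top of `P_T`, and maximality of `P_S` gives `P_T ⊆ P_S`, where
    -- `L` is constant.
    obtain ⟨r, hr, hrv, hlr⟩ : ∃ r ∈ section_ H T, r ≠ v ∧ l v ≤ l r := by
      by_contra! hall
      exact hLz.ne (hLW z (hmax T hTH hST hall hz))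
    obtain ⟨h₀, hh₀, hr₀⟩ : ∃ h ∈ S, h.normal r ≠ h.offset := by
      by_contra! hall
      exact (hlt r (mem_section.2 ⟨section_subset H T hr, hall⟩) hrv).not_ge hlr
    obtain ⟨x, hx, hgen⟩ := exists_generic (section_subset H S) (convex_section H S) ⟨v, hv⟩
    -- Moving towards `z` and away from `r` lowers `L`, as `L r ≥ L v`. The constraint gained is
    -- tight on `P_S` but not at `r`, so it enlarges `T`.
    obtain ⟨t, ε, ht, hε, hw, h, hh, hhx, hhr, hhw⟩ := exists_tight_of_sub_smul
      (section_subset H S hx) (section_subset H T hz) (section_subset H T hr)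
      (hS hh₀) ((mem_section.1 hx).2 h₀ hh₀) hr₀
    have hhT : h ∉ T := fun hhT => hhr ((mem_section.1 hr).2 h hhT)
    have hwT : x + ε • ((z - x) - t • (r - x)) ∈ section_ H T := by
      refine mem_section.2 ⟨hw, fun k hk => ?_⟩
      simp only [map_add, map_sub, map_smul, (mem_section.1 (hST hx)).2 k hk,
        (mem_section.1 hz).2 k hk, (mem_section.1 hr).2 k hk, sub_self, smul_zero, add_zero]
    have hLw : L (x + ε • ((z - x) - t • (r - x))) < L v := by
      simp only [map_add, map_sub, map_smul, smul_eq_mul, hLW x hx]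
      have h₁ : 0 ≤ t * (L r - L v) :=
        mul_nonneg ht (sub_nonneg.2 (hLle r (section_subset H T hr) hlr))
      have h₂ : ε * (L z - L v - t * (L r - L v)) < 0 :=
        mul_neg_of_pos_of_neg hε (by linarith)
      linarith
    have := hTmax (insert h T) (Finset.mem_filter.2
      ⟨Finset.mem_powerset.2 (Finset.insert_subset hh hTH),
        fun y hy => mem_section_insert.2 ⟨hST hy, hgen h hh hhx y hy⟩,
        _, mem_section_insert.2 ⟨hwT, hhw⟩, hLw⟩)
    rw [Finset.card_insert_of_notMem hhT] at this
    omega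
  refine ⟨R, fun h hh => (Finset.mem_filter.1 (hR hh)).1, hcard,
    mem_section.2 ⟨hvP, fun h hh => (Finset.mem_filter.1 (hR hh)).2⟩, fun z hz => ?_⟩
  have hz' := hLmin z (section_subset H R hz)
  rw [← sub_nonneg, ← map_sub, hLapp, linear_apply_sub] at hz'
  have : ∑ h ∈ R, μ h * h.normal (z - v) = 0 := Finset.sum_eq_zero fun h hh => by
    rw [map_sub, (mem_section.1 hz).2 h hh, (Finset.mem_filter.1 (hR hh)).2, sub_self, mul_zero]
  linarith

/-! ### Relative interior, and faces as sections -/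

/-- A point of the polyhedron at which only the constraints that are tight everywhere are tight
is in the relative interior. -/
theorem mem_intrinsicInterior_of_generic [FiniteDimensional ℝ E] {H : Finset (Halfspace E)} {x : E}
    (hx : x ∈ polyhedron H)
    (hgen : ∀ h ∈ H, h.normal x = h.offset → ∀ y ∈ polyhedron H, h.normal y = h.offset) :
    x ∈ intrinsicInterior ℝ (polyhedron H) := by
  classical
  refine mem_intrinsicInterior.2 ⟨⟨x, subset_affineSpan ℝ _ hx⟩, ?_, rfl⟩
  rw [mem_interior_iff_mem_nhds]
  have hev : ∀ᶠ y : affineSpan ℝ (polyhedron H) in 𝓝 ⟨x, subset_affineSpan ℝ _ hx⟩,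
      ∀ h ∈ H, h.normal (y : E) ≤ h.offset := by
    rw [Finset.eventually_all]
    intro h hh
    rcases (mem_polyhedron.1 hx h hh).eq_or_lt with heq | hlt
    · exact Eventually.of_forall fun y =>
        (normal_eq_of_mem_affineSpan (hgen h hh heq) y.2).le
    · have hc : Continuous fun y : affineSpan ℝ (polyhedron H) => h.normal (y : E) :=
        h.normal.continuous_of_finiteDimensional.comp continuous_subtype_val
      exact ((hc.tendsto _).eventually (gt_mem_nhds hlt)).mono fun y hy => hy.le
  exact hev.mono fun y hy => mem_polyhedron.2 hy

theorem exists_pos_sub_smul_mem_of_mem_intrinsicInterior {s : Set E} {x y : E}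
    (hx : x ∈ intrinsicInterior ℝ s) (hy : y ∈ s) :
    ∃ ε : ℝ, 0 < ε ∧ x + ε • (x - y) ∈ s := by
  obtain ⟨p, hp, rfl⟩ := mem_intrinsicInterior.1 hx
  have hyA : y ∈ affineSpan ℝ s := subset_affineSpan ℝ _ hy
  have hmem : ∀ ε : ℝ, (p : E) + ε • ((p : E) - y) ∈ affineSpan ℝ s := fun ε => by
    rw [add_comm]
    exact AffineSubspace.vadd_mem_of_mem_direction (Submodule.smul_mem _ _
      (AffineSubspace.vsub_mem_direction p.2 hyA)) p.2
  have hc : Continuous fun ε : ℝ =>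
      (⟨(p : E) + ε • ((p : E) - y), hmem ε⟩ : affineSpan ℝ s) := by
    refine Continuous.subtype_mk ?_ _
    fun_prop
  have h0 := (hc.tendsto 0).mono_left (nhdsWithin_le_nhds (s := Set.Ioi 0))
  simp only [zero_smul, add_zero] at h0
  obtain ⟨ε, hε, hpos⟩ :=
    ((h0.eventually (mem_interior_iff_mem_nhds.1 hp)).and self_mem_nhdsWithin).exists
  exact ⟨ε, hpos, hε⟩

/-- The segment from `y` to `x` extends slightly beyond `x` inside `P`, where a constraint tight at
`x` and slack at `y` would fail. -/
theorem normal_eq_of_mem_intrinsicInterior {H : Finset (Halfspace E)} {h : Halfspace E}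
    (hh : h ∈ H) {x : E} (hx : x ∈ intrinsicInterior ℝ (polyhedron H))
    (heq : h.normal x = h.offset) {y : E} (hy : y ∈ polyhedron H) : h.normal y = h.offset := by
  obtain ⟨ε, hε, hmem⟩ := exists_pos_sub_smul_mem_of_mem_intrinsicInterior hx hy
  have h₁ := mem_polyhedron.1 hmem h hh
  simp only [map_add, map_smul, map_sub, smul_eq_mul, heq] at h₁
  refine le_antisymm (mem_polyhedron.1 hy h hh) (sub_nonpos.1 ?_)
  exact nonpos_of_mul_nonpos_right (by linarith) hε

/-- A hyperplane missing the relative interior has a generic point of `P` strictly on one side,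
hence all of `P` weakly on that side. A nonempty face is thus `P` or its part in a supporting
hyperplane, and the latter is cut out by the constraints tight at a generic point of it. -/
theorem IsFace.isSection [FiniteDimensional ℝ E] {H : Finset (Halfspace E)} {f : Set E}
    (hf : IsFace (polyhedron H) f) : IsSection H f := by
  classical
  rcases hf with rfl | rfl | ⟨k, hdisj, rfl⟩
  · exact Or.inl rfl
  · exact Or.inr ⟨∅, Finset.empty_subset H, (section_empty H).symm⟩
  rcases (polyhedron H ∩ k.carrier).eq_empty_or_nonempty with hemp | hne
  · exact Or.inl hemp
  refine Or.inr ?_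
  obtain ⟨p, hp, hgen⟩ := exists_generic (H := H) subset_rfl (convex_polyhedron H)
    (hne.mono Set.inter_subset_left)
  -- The segment from a generic point `p` of the polyhedron to `z` cannot cross the boundary.
  have hcross : ∀ z ∈ polyhedron H, ∀ s : ℝ, 0 ≤ s → s < 1 →
      k.normal (p + s • (z - p)) ≠ k.offset := by
    intro z hz s hs hs1 heq
    have hmem : p + s • (z - p) ∈ polyhedron H :=
      (convex_polyhedron H).add_smul_sub_mem hp hz ⟨hs, hs1.le⟩
    refine Set.disjoint_left.1 hdisj heq (mem_intrinsicInterior_of_generic hmem ?_)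
    intro h hh hhw
    refine hgen h hh ?_
    have h₁ := mem_polyhedron.1 hp h hh
    have h₂ := mem_polyhedron.1 hz h hh
    simp only [map_add, map_smul, map_sub, smul_eq_mul] at hhw
    have h₃ := mul_le_mul_of_nonneg_left h₂ hs
    refine le_antisymm h₁ (le_of_mul_le_mul_left ?_ (sub_pos.2 hs1))
    linarith
  have hcross' : ∀ z ∈ polyhedron H, 0 < (k.offset - k.normal p) * (k.normal z - k.offset) →
      False := by
    intro z hz hpos
    have hne' : k.normal z - k.normal p ≠ 0 := by
      intro h0
      rw [sub_eq_zero.1 h0] at hpos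
      nlinarith [sq_nonneg (k.offset - k.normal p)]
    have hdiv : (k.offset - k.normal p) / (k.normal z - k.normal p) * (k.normal z - k.normal p)
        = k.offset - k.normal p := div_mul_cancel₀ _ hne'
    have hsq : 0 < (k.normal z - k.normal p) ^ 2 := by positivity
    refine hcross z hz ((k.offset - k.normal p) / (k.normal z - k.normal p)) ?_ ?_ ?_
    · rw [← mul_div_mul_right _ _ hne']
      refine div_nonneg ?_ (by nlinarith)
      nlinarith [sq_nonneg (k.offset - k.normal p)]
    · rw [← mul_div_mul_right _ _ hne', div_lt_one (by nlinarith)]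
      nlinarith [sq_nonneg (k.normal z - k.offset)]
    · simp only [map_add, map_smul, map_sub, smul_eq_mul, hdiv]
      ring
  have hpne : k.normal p ≠ k.offset := by simpa using hcross p hp 0 le_rfl one_pos
  rcases hpne.lt_or_gt with hlt | hgt
  · refine ⟨∅, Finset.empty_subset H, ?_⟩
    rw [section_empty]
    refine Set.inter_eq_left.2 fun z hz => show k.normal z ≤ k.offset from ?_
    by_contra! hz'
    exact hcross' z hz (mul_pos (sub_pos.2 hlt) (sub_pos.2 hz'))
  · have hge : ∀ z ∈ polyhedron H, k.offset ≤ k.normal z := fun z hz => by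
      by_contra! hz'
      exact hcross' z hz (mul_pos_of_neg_of_neg (sub_neg.2 hgt) (sub_neg.2 hz'))
    obtain ⟨x, hx, hxgen⟩ := exists_generic (H := H) (f := polyhedron H ∩ k.carrier)
      Set.inter_subset_left ((convex_polyhedron H).inter
        (convex_halfSpace_le k.normal.isLinear k.offset)) hne
    have hxk : k.normal x = k.offset := le_antisymm hx.2 (hge x hx.1)
    refine ⟨H.filter fun h => h.normal x = h.offset, Finset.filter_subset _ _,
      Set.Subset.antisymm (fun z hz => mem_section.2 ⟨hz.1, fun h hh => ?_⟩) fun z hz => ?_⟩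
    · obtain ⟨hhH, hhx⟩ := Finset.mem_filter.1 hh
      exact hxgen h hhH hhx z hz
    -- Continuing from `z` past `x` stays in `P`; since `x` is on the supporting hyperplane, `z`
    -- cannot be strictly off it.
    · obtain ⟨ε, hε, hmem⟩ := exists_pos_add_smul_mem (u := x - z) hx.1 fun h hh hhx => by
        rw [map_sub, hhx, (mem_section.1 hz).2 h (Finset.mem_filter.2 ⟨hh, hhx⟩), sub_self]
      have := hge _ hmem
      simp only [map_add, map_smul, map_sub, smul_eq_mul, hxk] at this
      refine ⟨section_subset _ _ hz, show k.normal z ≤ k.offset from sub_nonneg.1 ?_⟩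
      exact nonneg_of_mul_nonneg_right (by linarith) hε

/-! ### Membership in `F` -/

/-- A section on which `l` is bounded above and whose vertices all belong to `V` is in `F`. -/
theorem mem_of_forall_vertex_mem {H : Finset (Halfspace E)} {D d : ℕ}
    (hD : dim (polyhedron H) = (D : ℤ)) {l : E →ᵃ[ℝ] ℝ} {v₀ : E}
    (hv₀ : minFace l (polyhedron H) = {v₀}) {F : Set (Set E)} {V : Set E}
    (hF : ∀ f ∈ F, IsSection H f) (hempty : ∅ ∈ F) (h2 : ∀ f ∈ F, dim f ≤ (d : ℤ))
    (h3 : ∀ f ∈ F, ∀ v ∈ V,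
      (((affineSpan ℝ (f ∪ {v}) : Set E) ∩ intrinsicInterior ℝ (polyhedron H)).Nonempty ∧
        (d : ℤ) < (D : ℤ) - 1) ∨
      (∃ f' ∈ F, affineSpan ℝ f' = affineSpan ℝ (f ∪ {v})) ∨
      ¬ Bornology.IsBounded (l '' ((affineSpan ℝ (f ∪ {v}) : Set E) ∩ polyhedron H)))
    {f : Set E} (hf : IsSection H f) {c : ℝ} (hc : ∀ x ∈ f, l x ≤ c)
    (hV : ∀ w ∈ f, ∀ T ⊆ H, section_ H T = {w} → w ∈ V) : f ∈ F := by
  by_contra hfF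
  obtain ⟨g, ⟨hg, hgf, hgF⟩, hmin⟩ := Set.Finite.exists_minimal
    (s := {g | IsSection H g ∧ g ⊆ f ∧ g ∉ F})
    ((finite_isSection H).subset fun g hg => hg.1) ⟨f, hf, subset_rfl, hfF⟩
  have hgne : g.Nonempty := by
    rw [Set.nonempty_iff_ne_empty]
    rintro rfl
    exact hgF hempty
  obtain ⟨S, hS, rfl⟩ : ∃ S ⊆ H, g = section_ H S := by
    rcases hg with rfl | hg
    · exact absurd hgne Set.not_nonempty_empty
    · exact hg
  have hcS : ∀ x ∈ section_ H S, l x ≤ c := fun x hx => hc x (hgf hx)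
  obtain ⟨v, hv, T, hT, hTv⟩ := exists_vertex hv₀ hS hgne hcS
  obtain ⟨f', hf', hf'S, hvf', hspan⟩ := exists_facet hv₀ hS hv hcS
  have hf'F : f' ∈ F := by
    by_contra hf'F
    exact hvf' (hmin ⟨hf', hf'S.trans hgf, hf'F⟩ hf'S hv)
  -- Alternative (a) makes the section all of `P`, yet of dimension at most `d + 1 < D`; (b) puts it
  -- in `F`; (c) fails because `l` lies between `l v₀` and `c`.
  rcases h3 f' hf'F v (hV v (hgf hv) T hT hTv) with ⟨⟨p, hpA, hpI⟩, hdD⟩ | ⟨f'', hf'', hspan'⟩ | hunb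
  · rw [hspan] at hpA
    have hSP : section_ H S = polyhedron H :=
      Set.Subset.antisymm (section_subset H S) fun y hy => mem_section.2 ⟨hy, fun h hh =>
        normal_eq_of_mem_intrinsicInterior (hS hh) hpI (normal_eq_of_mem_affineSpan
          (fun z hz => (mem_section.1 hz).2 h hh) hpA) hy⟩
    have h₁ := dim_union_singleton_le f' v
    rw [dim_eq_of_affineSpan_eq hspan, hSP, hD] at h₁
    have := h2 f' hf'F
    omega
  · rw [hspan] at hspan'
    refine hgF ?_
    rcases hF f'' hf'' with rfl | ⟨S'', -, rfl⟩
    · rw [AffineSubspace.span_empty, eq_comm, affineSpan_eq_bot] at hspan'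
      rwa [hspan']
    · rwa [← affineSpan_section_inter H S, ← hspan', affineSpan_section_inter]
  · rw [hspan, affineSpan_section_inter] at hunb
    have hv₀' : v₀ ∈ minFace l (polyhedron H) := hv₀ ▸ Set.mem_singleton v₀
    refine hunb ((Metric.isBounded_Icc (l v₀) c).subset ?_)
    rintro _ ⟨x, hx, rfl⟩
    exact ⟨hv₀'.2 x (section_subset H S hx), hcS x hx⟩

end BoundedFaces

/-! ### The main theorem -/

open BoundedFaces

theorem mainTheorem9 {E : Type*} [NormedAddCommGroup E] [NormedSpace ℝ E] [FiniteDimensional ℝ E]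
    (H : Finset (BoundedFaces.Halfspace E)) (D d : ℕ)
    (hD : BoundedFaces.dim (BoundedFaces.polyhedron H) = (D : ℤ)) (hd : d ≤ D)
    (l : E →ᵃ[ℝ] ℝ) (F : Set (Set E))
    (hF : F ⊆ BoundedFaces.boundedSubcomplex (BoundedFaces.polyhedron H))
    (hempty : ∅ ∈ F)
    (h1 : ∀ S ⊆ H, S.card ≤ d + 1 → (BoundedFaces.section_ H S).Nonempty →
      ∃ v ∈ BoundedFaces.minVertices H l d,
        BoundedFaces.minFace l (BoundedFaces.section_ H S) = {v})
    (h2 : ∀ f ∈ F, BoundedFaces.dim f ≤ (d : ℤ))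
    (h3 : ∀ f ∈ F, ∀ v ∈ BoundedFaces.minVertices H l d,
      (((affineSpan ℝ (f ∪ {v}) : Set E) ∩
          intrinsicInterior ℝ (BoundedFaces.polyhedron H)).Nonempty ∧ (d : ℤ) < (D : ℤ) - 1) ∨
      (∃ f' ∈ F, affineSpan ℝ f' = affineSpan ℝ (f ∪ {v})) ∨
      ¬ Bornology.IsBounded
          (l '' ((affineSpan ℝ (f ∪ {v}) : Set E) ∩ BoundedFaces.polyhedron H))) :
    F = BoundedFaces.boundedSubcomplex (BoundedFaces.polyhedron H) := by
  have hPne : (polyhedron H).Nonempty := by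
    rw [Set.nonempty_iff_ne_empty]
    intro h
    rw [h, dim, if_pos rfl] at hD
    omega
  obtain ⟨v₀, -, hv₀⟩ := h1 ∅ (Finset.empty_subset H) (by simp) (by rwa [section_empty])
  rw [section_empty] at hv₀
  have hFs : ∀ f ∈ F, IsSection H f := fun f hf => (hF hf).1.isSection
  have hmem : ∀ {f : Set E}, IsSection H f → ∀ {c : ℝ}, (∀ x ∈ f, l x ≤ c) →
      (∀ w ∈ f, ∀ T ⊆ H, section_ H T = {w} → w ∈ minVertices H l d) → f ∈ F :=
    fun hf _ hc hV => mem_of_forall_vertex_mem hD hv₀ hFs hempty h2 h3 hf hc hV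
  have hvert : ∀ v, ∀ T ⊆ H, section_ H T = {v} → v ∈ minVertices H l d := by
    by_contra! hex
    obtain ⟨v, ⟨⟨T, hT, hTv⟩, hvV⟩, hlow⟩ := Set.exists_min_image
      {v | (∃ T ⊆ H, section_ H T = {v}) ∧ v ∉ minVertices H l d} l
      (by
        refine Set.Finite.of_finite_image ((finite_isSection H).subset ?_)
          Set.singleton_injective.injOn
        rintro _ ⟨v, ⟨⟨T, hT, hTv⟩, -⟩, rfl⟩
        exact Or.inr ⟨T, hT, hTv.symm⟩)
      (by
        obtain ⟨v, T, hT, hTv, hv⟩ := hex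
        exact ⟨v, ⟨T, hT, hTv⟩, hv⟩)
    -- The family is nonempty because `{v}` qualifies vacuously.
    obtain ⟨g, ⟨⟨S, hS, rfl⟩, hvS, hlt⟩, hmax⟩ := Set.Finite.exists_maximal
      (s := {g | (∃ S ⊆ H, g = section_ H S) ∧ v ∈ g ∧ ∀ x ∈ g, x ≠ v → l x < l v})
      ((finite_isSection H).subset fun g hg => Or.inr hg.1)
      ⟨{v}, ⟨T, hT, hTv.symm⟩, rfl, fun x hx hxv => absurd hx hxv⟩
    have hle : ∀ x ∈ section_ H S, l x ≤ l v := fun x hx => by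
      by_cases hxv : x = v
      · rw [hxv]
      · exact (hlt x hx hxv).le
    obtain ⟨f', hf', hf'S, hvf', hspan⟩ := exists_facet hv₀ hS hvS hle
    have hf'F : f' ∈ F := by
      refine hmem hf' (fun x hx => hle x (hf'S hx)) fun w hw T' hT' hTw => ?_
      by_contra hwV
      exact (hlt w (hf'S hw) (fun h => hvf' (h ▸ hw))).not_ge (hlow w ⟨⟨T', hT', hTw⟩, hwV⟩)
    have hdim := dim_union_singleton_le f' v
    rw [dim_eq_of_affineSpan_eq hspan, dim, if_neg (Set.nonempty_of_mem hvS).ne_empty] at hdim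
    have hdim' := h2 f' hf'F
    obtain ⟨R, hR, hcard, hvR⟩ := exists_mem_minFace hS hvS hlt fun T' hT' hsub hlt' =>
      hmax ⟨⟨T', hT', rfl⟩, hsub hvS, hlt'⟩ hsub
    -- The size of `R` is at most `dim f' + 1 ≤ d + 1`, just what condition 1 admits.
    obtain ⟨w, hw, hwR⟩ := h1 R hR (by omega) ⟨v, hvR.1⟩
    rw [hwR, Set.mem_singleton_iff] at hvR
    exact hvV (hvR ▸ hw)
  refine Set.Subset.antisymm hF fun f hf => ?_
  have hbdd : BddAbove (l '' f) := by
    have hcompact := hf.2.isCompact_closure.image l.continuous_of_finiteDimensional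
    exact hcompact.bddAbove.mono (Set.image_mono subset_closure)
  obtain ⟨c, hc⟩ := hbdd
  exact hmem hf.1.isSection (fun x hx => hc ⟨x, hx, rfl⟩) fun w _ T hT hTw => hvert w T hT hTw
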